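/- Let $X$ be a locally compact metric space with metric $d$, and let $\mathcal F=\{f_1,\dots,f_m\}$ be an iterated function system (IFS) on $X$, i.e. a finite family of continuous maps $f_i:X\to X$. For a finite word $I=i_1\cdots i_k$ in $\{1,\dots,m\}$ of length $|I|=k\ge 0$ put $\Phi^I=f_{i_k}\circ\cdots\circ f_{i_1}$ (the identity if $k=0$), and let $\mathcal O_{\mathcal F}=\{(x,\Phi^I(x)) : x\in X,\ I \text{ a finite word}\}$ be the orbit relation. A set $A\subset X$ is $H$-invariant if $A=f_1(A)\cup\dots\cup f_m(A)$; it attracts $K\subset X$ if for every $\varepsilon>0$ there is $\tau>0$ such that $\Phi^I(K)\subset\{x: d(x,A)<\varepsilon\}$ whenever $|I|\ge\tau$ (with $d(x,\emptyset)=\infty$). $\mathcal F$ has compact dynamics if it has a global attractor, i.e. if among the $H$-invariant compact sets that attract every compact subset of $X$ there is a largest one. A stream of $\mathcal F$ is a quasi-order (reflexive, transitive relation) $S\subset X\times X$ that is closed and contains $\mathcal O_{\mathcal F}$. The smallest stream $\mathcal A_{\mathcal F}$ is the intersection of all streams. Points $x,y$ are $S$-equivalent if $(x,y)\in S$ and $(y,x)\in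 S$. A point $x$ is weakly $S$-recurrent if $f_i(x)=x$ for some $i$, or $x$ is $S$-equivalent to some $y\ne x$. The weak nodes of $S$ are the $S$-equivalence classes of weakly $S$-recurrent points. For $\varepsilon>0$, an $\varepsilon$-chain from $x$ to $y$ consists of points $x=x_0,x_1,\dots,x_k=y$ ($k\ge 0$) and indices $i_0,\dots,i_{k-1}\in\{1,\dots,m\}$ with $d(f_{i_n}(x_n),x_{n+1})<\varepsilon$ for $0\le n<k$. The chain stream $\mathcal C_{\mathcal F}$ is the set of all $(x,y)\in X\times X$ such that for every $\varepsilon>0$ there is an $\varepsilon$-chain from $x$ to $y$. **Theorem.** If $\mathcal F$ has compact dynamics and $\mathcal A_{\mathcal F}$ has (at most) countably many weak nodes, then $\mathcal A_{\mathcal F}=\mathcal C_{\mathcal F}$. -/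

import Mathlib

/-- An iterated function system: a finite family `f₁, …, fₘ` of continuous self-maps of `X`. -/
abbrev IFS (m : ℕ) (X : Type*) [TopologicalSpace X] := Fin m → C(X, X)

namespace IFS

variable {m : ℕ} {X : Type*}

section Topological

variable [TopologicalSpace X]

/-- The semiflow: `flow F I x` applies the maps with indices listed in the multi-index `I`, the first
index first, so that `flow F (I ++ J) = flow F J ∘ flow F I` and `flow F [] = id`. -/
def flow (F : IFS m X) (I : List (Fin m)) (x : X) : X :=
  I.foldl (fun y i => F i y) x

/-- The orbit relation: all pairs `(x, Φ^I(x))`. -/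
def orbitRel (F : IFS m X) : Set (X × X) :=
  {p | ∃ I : List (Fin m), p.2 = F.flow I p.1}

/-- `A` is `H`-invariant: `A = f₁(A) ∪ … ∪ fₘ(A)`. -/
def HInvariant (F : IFS m X) (A : Set X) : Prop :=
  A = ⋃ i, F i '' A

/-- A stream: a closed quasi-order containing the orbit relation. -/
structure IsStream (F : IFS m X) (S : Set (X × X)) : Prop where
  isClosed : IsClosed S
  refl : ∀ x, (x, x) ∈ S
  trans : ∀ x y z, (x, y) ∈ S → (y, z) ∈ S → (x, z) ∈ S
  orbitRel_subset : F.orbitRel ⊆ S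

/-- The smallest stream: the intersection of all streams. -/
def smallestStream (F : IFS m X) : Set (X × X) :=
  ⋂₀ {S | F.IsStream S}

end Topological

/-- `x` and `y` are `S`-equivalent: each is `S`-downstream from the other. -/
def StreamEquiv (S : Set (X × X)) (x y : X) : Prop :=
  (x, y) ∈ S ∧ (y, x) ∈ S

/-- `x` is weakly `S`-recurrent: it is fixed by one of the maps of the system, or it is
`S`-equivalent to some point other than itself. -/
def WeaklyRecurrent [TopologicalSpace X] (F : IFS m X) (S : Set (X × X)) (x : X) : Prop :=
  (∃ i, F i x = x) ∨ ∃ y, y ≠ x ∧ StreamEquiv S x y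

/-- The weak nodes of `S`: the `S`-equivalence classes of weakly `S`-recurrent points.  (A point that
is `S`-equivalent to a weakly `S`-recurrent point is itself weakly `S`-recurrent.) -/
def weakNodes [TopologicalSpace X] (F : IFS m X) (S : Set (X × X)) : Set (Set X) :=
  {N | ∃ x, F.WeaklyRecurrent S x ∧ N = {y | StreamEquiv S x y}}

section Metric

variable [MetricSpace X]

/-- `A` attracts `K`: for every `ε > 0`, the images of `K` under all `Φ^I` with `I` long enough lie
in the open `ε`-neighbourhood of `A` (which is empty for `A = ∅`). -/
def Attracts (F : IFS m X) (A K : Set X) : Prop :=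
  ∀ ε : ℝ, 0 < ε → ∃ τ : ℕ, 0 < τ ∧ ∀ I : List (Fin m), τ ≤ I.length →
    F.flow I '' K ⊆ Metric.thickening ε A

/-- A global attractor: the largest `H`-invariant compact set attracting every compact set. -/
def IsGlobalAttractor (F : IFS m X) (G : Set X) : Prop :=
  IsGreatest {A : Set X | IsCompact A ∧ F.HInvariant A ∧ ∀ K, IsCompact K → F.Attracts A K} G

/-- Compact dynamics: there is a global attractor. -/
def CompactDynamics (F : IFS m X) : Prop :=
  ∃ G, F.IsGlobalAttractor G

/-- There is an `ε`-chain from `x` to `y`: points `x = x₀, …, x_k = y` and indices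
`i₀, …, i_{k-1}` with `d(f_{iₙ}(xₙ), xₙ₊₁) < ε`.  The trivial chain (`k = 0`) is allowed, as the
trivial multi-index is in the orbit relation. -/
def HasChain (F : IFS m X) (ε : ℝ) (x y : X) : Prop :=
  ∃ (k : ℕ) (p : Fin (k + 1) → X) (i : Fin k → Fin m),
    p 0 = x ∧ p (Fin.last k) = y ∧ ∀ n : Fin k, dist (F (i n) (p n.castSucc)) (p n.succ) < ε

/-- The chain stream: pairs joined by `ε`-chains for every `ε > 0`. -/
def chainStream (F : IFS m X) : Set (X × X) :=
  {p | ∀ ε : ℝ, 0 < ε → F.HasChain ε p.1 p.2}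

end Metric

end IFS

open Set Topology

/-! The chain stream is itself a stream, so only the inclusion of `chainStream` in `smallestStream`
needs an argument. Suppose a chain pair (x, y) lies outside S = `smallestStream`. Compact dynamics
confines fine chains from x to a compact set K (`CompactDynamics.exists_isCompact_trapping`). On K,
Urysohn's construction run through forward-invariant open sets gives a continuous L, nonincreasing
along S, constant only along equivalent pairs, with L x < L y. Since L is constant on each weak
node, countability leaves a level c between L x and L y that is not the value of any weakly
recurrent point. Every map then sends {L ≤ c} into {L < c}, by compactness with a uniform margin, so
fine chains cannot cross the level c (`IsStream.mem_of_mem_chainStream`). -/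

/-! ### Lyapunov functions for closed quasi-orders -/

/-- A closed quasi-order on a compact space admits, for every pair `(a, b)` outside it, a continuous
function that is nonincreasing along the relation and has value `0` at `a` and `1` at `b`. -/
theorem exists_continuous_antitone_separating {Y : Type*} [TopologicalSpace Y] [CompactSpace Y]
    [T2Space Y] {S : Set (Y × Y)} (hS : IsClosed S) (hrefl : ∀ x, (x, x) ∈ S)
    (htrans : ∀ x y z, (x, y) ∈ S → (y, z) ∈ S → (x, z) ∈ S) {a b : Y} (hab : (a, b) ∉ S) :
    ∃ L : C(Y, ℝ), (∀ z w, (z, w) ∈ S → L w ≤ L z) ∧ (∀ z, L z ∈ Icc (0 : ℝ) 1) ∧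
      L a = 0 ∧ L b = 1 := by
  have hopen : ∀ u : Set Y, IsOpen u → IsOpen {z | ∀ w, (z, w) ∈ S → w ∈ u} := by
    intro u hu
    have h := isClosedMap_fst_of_compactSpace (X := Y) (Y := Y) _
      (hS.inter (hu.isClosed_compl.preimage continuous_snd))
    rw [← isClosed_compl_iff]
    convert h using 1
    ext z
    simp
  have himage : ∀ c : Set Y, IsClosed c → IsClosed {w | ∃ z ∈ c, (z, w) ∈ S} := by
    intro c hc
    have h := isClosedMap_snd_of_compactSpace (X := Y) (Y := Y) _
      (hS.inter (hc.preimage continuous_fst))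
    convert h using 1
    ext w
    simp [and_comm]
  -- Besides containing everything downstream of `c`, `u` must be forward-invariant. The Urysohn
  -- approximants then average indicators of complements of forward-invariant sets, hence are
  -- nonincreasing along `S`.
  let P : Set Y → Set Y → Prop := fun c u =>
    (∀ z ∈ c, ∀ w, (z, w) ∈ S → w ∈ u) ∧ ∀ z ∈ u, ∀ w, (z, w) ∈ S → w ∈ u
  let c : Urysohns.CU P :=
    { C := {a}
      U := {z | (z, b) ∉ S}
      P_C_U := by
        refine ⟨?_, fun z hz w hzw hw => hz (htrans _ _ _ hzw hw)⟩
        rintro z rfl w hzw hw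
        exact hab (htrans _ _ _ hzw hw)
      closed_C := isClosed_singleton
      open_U := by
        have : IsClosed {z | (z, b) ∈ S} := hS.preimage (by fun_prop)
        exact this.isOpen_compl
      subset := by
        rintro z rfl
        exact hab
      hP := by
        rintro c u hc ⟨hcu, huu⟩ hu -
        obtain ⟨v, hv, hcv, hvu⟩ := normal_exists_closure_subset (himage c hc)
          (hopen u hu) (by
            rintro w ⟨z, hz, hzw⟩ t hwt
            exact hcu z hz t (htrans _ _ _ hzw hwt))
        have hsub : {z | ∀ w, (z, w) ∈ S → w ∈ v} ⊆ v := fun z hz => hz z (hrefl z)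
        refine ⟨_, hopen v hv, fun z hz w hzw => hcv ⟨z, hz, hzw⟩, ?_, ⟨?_, ?_⟩, ?_, huu⟩
        · exact fun z hz => hvu (closure_mono hsub hz) z (hrefl z)
        · exact fun z hz w hzw t hwt => hcv ⟨z, hz, htrans _ _ _ hzw hwt⟩
        · exact fun z hz w hzw t hwt => hz t (htrans _ _ _ hzw hwt)
        · exact fun z hz => hvu (closure_mono hsub hz) }
  have hmono : ∀ (n : ℕ) (c : Urysohns.CU P) (z w : Y), (z, w) ∈ S →
      c.approx n w ≤ c.approx n z := by
    intro n
    induction n with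
    | zero =>
      intro c z w hzw
      by_cases hz : z ∈ c.U
      · have hw := c.P_C_U.2 z hz w hzw
        simp [Urysohns.CU.approx, hz, hw]
      · rw [c.approx_of_notMem_U 0 hz]
        exact c.approx_le_one 0 w
    | succ n ih =>
      intro c z w hzw
      exact midpoint_le_midpoint (ih _ _ _ hzw) (ih _ _ _ hzw)
  refine ⟨⟨c.lim, c.continuous_lim⟩, fun z w hzw => ?_, fun z => c.lim_mem_Icc z,
    c.lim_of_mem_C a rfl, c.lim_of_notMem_U b (fun h => h (hrefl b))⟩
  exact ciSup_mono (c.bddAbove_range_approx z) fun n => hmono n c z w hzw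

/-- A closed quasi-order on a compact metric space admits a continuous function that is nonincreasing
along the relation, and constant only along pairs related in both directions. -/
theorem exists_continuous_strictly_antitone {Y : Type*} [MetricSpace Y] [CompactSpace Y]
    {S : Set (Y × Y)} (hS : IsClosed S) (hrefl : ∀ x, (x, x) ∈ S)
    (htrans : ∀ x y z, (x, y) ∈ S → (y, z) ∈ S → (x, z) ∈ S) :
    ∃ g : C(Y, ℝ), (∀ z w, (z, w) ∈ S → g w ≤ g z) ∧
      ∀ z w, (z, w) ∈ S → (w, z) ∉ S → g w < g z := by
  let M : Set C(Y, ℝ) := {L | (∀ z w, (z, w) ∈ S → L w ≤ L z) ∧ ∀ z, L z ∈ Icc (0 : ℝ) 1}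
  have hM : (0 : C(Y, ℝ)) ∈ M := ⟨fun _ _ _ => le_rfl, fun _ => by simp⟩
  -- By the separation theorem these open sets cover the complement of `S`; Lindelöf leaves
  -- countably many functions, to be summed with geometric weights. Adjoining 0 makes the family
  -- nonempty, so that it can be enumerated.
  obtain ⟨T, hT, hTU⟩ := TopologicalSpace.isOpen_iUnion_countable
    (fun L : M => {p : Y × Y | L.1 p.1 < L.1 p.2})
    (fun L => isOpen_lt (L.1.continuous.comp continuous_fst) (L.1.continuous.comp continuous_snd))
  obtain ⟨L, hL⟩ := (hT.insert ⟨0, hM⟩).exists_eq_range (insert_nonempty _ _)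
  have hmono : ∀ n z w, (z, w) ∈ S → (L n).1 w ≤ (L n).1 z := fun n => (L n).2.1
  have hbound : ∀ n z, ‖(1 / 2 : ℝ) ^ n * (L n).1 z‖ ≤ (1 / 2 : ℝ) ^ n := by
    intro n z
    obtain ⟨h0, h1⟩ := (L n).2.2 z
    rw [norm_mul, Real.norm_of_nonneg h0, norm_pow, Real.norm_of_nonneg (by norm_num)]
    exact mul_le_of_le_one_right (by positivity) h1
  have hsum : ∀ z, Summable fun n => (1 / 2 : ℝ) ^ n * (L n).1 z := fun z =>
    Summable.of_norm_bounded summable_geometric_two fun n => hbound n z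
  refine ⟨⟨fun z => ∑' n, (1 / 2 : ℝ) ^ n * (L n).1 z,
    continuous_tsum (fun n => continuous_const.mul (L n).1.continuous) summable_geometric_two
      hbound⟩, fun z w hzw => ?_, fun z w hzw hwz => ?_⟩
  · exact (hsum w).tsum_le_tsum (fun n => by have := hmono n z w hzw; gcongr) (hsum z)
  · obtain ⟨K, hK, hK01, hw0, hz1⟩ := exists_continuous_antitone_separating hS hrefl htrans hwz
    have hmem : (w, z) ∈ ⋃ L : M, {p : Y × Y | L.1 p.1 < L.1 p.2} :=
      mem_iUnion.2 ⟨⟨K, hK, hK01⟩, by simp [hw0, hz1]⟩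
    rw [← hTU] at hmem
    obtain ⟨N, hN, hlt⟩ := mem_iUnion₂.1 hmem
    obtain ⟨n, rfl⟩ : N ∈ range L := hL ▸ mem_insert_of_mem _ hN
    have hlt' : (L n).1 w < (L n).1 z := hlt
    exact Summable.tsum_lt_tsum (i := n)
      (fun k => by have := hmono k z w hzw; dsimp only; gcongr) (by gcongr)
      (hsum w) (hsum z)

/-! ### Chains and the chain stream -/

namespace IFS

section Topological

variable {m : ℕ} {X : Type*} [TopologicalSpace X]

theorem continuous_flow (F : IFS m X) (I : List (Fin m)) : Continuous (F.flow I) := by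
  induction I with
  | nil => exact continuous_id
  | cons i I ih => exact ih.comp (F i).continuous

theorem isStream_smallestStream (F : IFS m X) : F.IsStream F.smallestStream where
  isClosed := isClosed_sInter fun _ hS => hS.isClosed
  refl x := fun _ hS => hS.refl x
  trans x y z hxy hyz := fun S hS => hS.trans x y z (hxy S hS) (hyz S hS)
  orbitRel_subset := subset_sInter fun _ hS => hS.orbitRel_subset

theorem IsStream.map_mem {F : IFS m X} {S : Set (X × X)} (hS : F.IsStream S) (i : Fin m) (x : X) :
    (x, F i x) ∈ S :=
  hS.orbitRel_subset ⟨[i], rfl⟩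

end Topological

variable {m : ℕ} {X : Type*} [MetricSpace X]

theorem hasChain_iff_reflTransGen (F : IFS m X) {ε : ℝ} {x y : X} :
    F.HasChain ε x y ↔ Relation.ReflTransGen (fun a b => ∃ i, dist (F i a) b < ε) x y := by
  constructor
  · rintro ⟨k, p, i, rfl, rfl, h⟩
    have : ∀ j : Fin (k + 1),
        Relation.ReflTransGen (fun a b => ∃ i, dist (F i a) b < ε) (p 0) (p j) := by
      intro j
      induction j using Fin.induction with
      | zero => exact .refl
      | succ j ih => exact ih.tail ⟨i j, h j⟩
    exact this _
  · intro h
    induction h using Relation.ReflTransGen.head_induction_on with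
    | refl => exact ⟨0, fun _ => y, Fin.elim0, rfl, rfl, fun n => n.elim0⟩
    | @head a c hac _ ih =>
      obtain ⟨i₀, hi₀⟩ := hac
      obtain ⟨k, p, i, rfl, hy, h⟩ := ih
      refine ⟨k + 1, Fin.cons a p, Fin.cons i₀ i, rfl, ?_, fun n => ?_⟩
      · rw [← Fin.succ_last, Fin.cons_succ, hy]
      · cases n using Fin.cases with
        | zero => simpa using hi₀
        | succ n => simpa using h n

theorem HasChain.mem_of_trapping {F : IFS m X} {ε : ℝ} {Q : Set X}
    (hQ : ∀ z ∈ Q, ∀ i w, dist (F i z) w < ε → w ∈ Q) {x y : X} (h : F.HasChain ε x y)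
    (hx : x ∈ Q) : y ∈ Q := by
  rw [hasChain_iff_reflTransGen] at h
  induction h with
  | refl => exact hx
  | tail _ h ih => exact h.elim fun i hi => hQ _ ih i _ hi

/-- A chain between nearby points becomes one from x to y by moving its two endpoints, at a cost of
ε/3 each. Moving an endpoint requires a nontrivial chain, hence the conditions a ≠ b and a ≠ y. -/
theorem isClosed_chainStream (F : IFS m X) : IsClosed F.chainStream := by
  refine isClosed_of_closure_subset fun p hp ε hε => ?_
  obtain ⟨x, y⟩ := p
  rw [hasChain_iff_reflTransGen]
  by_cases hxy : x = y
  · rw [← hxy]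
  have hnhds : {q : X × X | q.1 ≠ q.2 ∧ q.1 ≠ y ∧ dist q.2 y < ε / 3 ∧
      ∀ i, dist (F i x) (F i q.1) < ε / 3} ∈ 𝓝 (x, y) := by
    refine IsOpen.mem_nhds ?_
      ⟨hxy, hxy, by simpa using by positivity, fun i => by simpa using by positivity⟩
    refine (isOpen_ne_fun continuous_fst continuous_snd).inter
      ((isOpen_ne_fun continuous_fst continuous_const).inter
        ((isOpen_lt (continuous_snd.dist continuous_const) continuous_const).inter ?_))
    have h : IsOpen (⋂ i, {q : X × X | dist (F i x) (F i q.1) < ε / 3}) :=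
      isOpen_iInter_of_finite fun i => isOpen_lt
        (continuous_const.dist ((F i).continuous.comp continuous_fst)) continuous_const
    rwa [← ofPred_forall] at h
  obtain ⟨⟨a, b⟩, ⟨hab, hay, hb, ha⟩, hC⟩ := mem_closure_iff_nhds.1 hp _ hnhds
  dsimp only at hab hay hb ha hC
  have hmono : ∀ {δ η : ℝ} {s t : X}, δ ≤ η →
      Relation.ReflTransGen (fun a b => ∃ i, dist (F i a) b < δ) s t →
      Relation.ReflTransGen (fun a b => ∃ i, dist (F i a) b < η) s t :=
    fun hδ h => Relation.ReflTransGen.mono (fun _ _ ⟨i, hi⟩ => ⟨i, hi.trans_le hδ⟩) _ _ h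
  have hay' : Relation.ReflTransGen (fun a b => ∃ i, dist (F i a) b < 2 * ε / 3) a y := by
    obtain h | ⟨d, had, j, hj⟩ :=
      ((F.hasChain_iff_reflTransGen).1 (hC (ε / 3) (by positivity))).cases_tail
    · exact absurd h.symm hab
    · exact (hmono (by linarith) had).tail ⟨j, by linarith [dist_triangle (F j d) b y]⟩
  obtain h | ⟨c, ⟨i, hi⟩, hcy⟩ := hay'.cases_head
  · exact absurd h hay
  · exact (hmono (by linarith) hcy).head ⟨i, by
      linarith [dist_triangle (F i x) (F i a) c, ha i]⟩

theorem isStream_chainStream (F : IFS m X) : F.IsStream F.chainStream where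
  isClosed := F.isClosed_chainStream
  refl x := fun ε _ => (F.hasChain_iff_reflTransGen).2 .refl
  trans x y z hxy hyz := fun ε hε => (F.hasChain_iff_reflTransGen).2
    (((F.hasChain_iff_reflTransGen).1 (hxy ε hε)).trans
      ((F.hasChain_iff_reflTransGen).1 (hyz ε hε)))
  orbitRel_subset := by
    rintro ⟨x, y⟩ ⟨I, hI⟩ ε hε
    dsimp only at hI ⊢
    subst hI
    rw [hasChain_iff_reflTransGen]
    induction I generalizing x with
    | nil => exact .refl
    | cons i I ih => exact (ih (F i x)).head ⟨i, by simpa using hε⟩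

/-! ### Compact trapping sets -/

/-- If all words of length `n + 1` map the compact set `C` into the open set `U`, then `C` extends to
a compact set that `ε`-chains can only leave through `U`. -/
theorem exists_isCompact_leaving_through [LocallyCompactSpace X] (F : IFS m X) (n : ℕ) {C U : Set X}
    (hC : IsCompact C) (hU : IsOpen U)
    (h : ∀ I : List (Fin m), I.length = n + 1 → F.flow I '' C ⊆ U) :
    ∃ K, IsCompact K ∧ C ⊆ K ∧
      ∃ ε > 0, ∀ z ∈ K, ∀ i w, dist (F i z) w < ε → w ∈ K ∪ U := by
  have himage : ∀ {C : Set X}, IsCompact C → IsCompact (⋃ i, F i '' C) :=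
    fun hC => isCompact_iUnion fun i => hC.image (F i).continuous
  have hthick : ∀ {C V : Set X}, IsCompact C → IsOpen V → ⋃ i, F i '' C ⊆ V →
      ∃ ε > 0, ∀ z ∈ C, ∀ i w, dist (F i z) w < ε → w ∈ V := by
    intro C V hC hV hsub
    obtain ⟨ε, hε, hεV⟩ := (himage hC).exists_thickening_subset_open hV hsub
    refine ⟨ε, hε, fun z hz i w hw => hεV (Metric.mem_thickening_iff.2 ⟨F i z, ?_, ?_⟩)⟩
    · exact mem_iUnion.2 ⟨i, mem_image_of_mem _ hz⟩
    · rwa [dist_comm]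
  induction n generalizing C with
  | zero =>
    obtain ⟨ε, hε, hεU⟩ := hthick hC hU (iUnion_subset fun i => h [i] rfl)
    exact ⟨C, hC, Subset.rfl, ε, hε, fun z hz i w hw => Or.inr (hεU z hz i w hw)⟩
  | succ n ih =>
    have hW : IsOpen (⋂ I ∈ {I : List (Fin m) | I.length = n + 1}, F.flow I ⁻¹' U) :=
      (List.finite_length_eq (Fin m) (n + 1)).isOpen_biInter
        fun I _ => hU.preimage (F.continuous_flow I)
    -- `C'` is a compact neighbourhood of the one-step image of `C`, leaving room for the jump of a
    -- chain, and words one letter shorter still send it into `U`.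
    obtain ⟨C', hC', hsub, hsub'⟩ := exists_compact_between (himage hC) hW (by
      refine iUnion_subset fun i => ?_
      rintro _ ⟨z, hz, rfl⟩
      refine mem_iInter₂.2 fun I hI => h (i :: I) ?_ (mem_image_of_mem _ hz)
      simpa using hI)
    obtain ⟨K, hK, hC'K, ε, hε, hKU⟩ := ih hC' (fun I hI => by
      rintro _ ⟨z, hz, rfl⟩
      exact mem_iInter₂.1 (hsub' hz) I hI)
    obtain ⟨δ, hδ, hδC⟩ := hthick hC isOpen_interior hsub
    refine ⟨C ∪ K, hC.union hK, subset_union_left, min δ ε, lt_min hδ hε, ?_⟩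
    rintro z (hz | hz) i w hw
    · exact Or.inl (Or.inr (hC'K (interior_subset (hδC z hz i w (hw.trans_le (min_le_left _ _))))))
    · exact (hKU z hz i w (hw.trans_le (min_le_right _ _))).imp_left Or.inr

/-- Long words bring a compact neighbourhood `K₀` of the attractor and x back into its own interior.
Chains could leave `K` only through that interior, which already lies in `K`. -/
theorem CompactDynamics.exists_isCompact_trapping [LocallyCompactSpace X] {F : IFS m X}
    (hF : F.CompactDynamics) (x : X) :
    ∃ K, IsCompact K ∧ x ∈ K ∧ ∃ ε > 0, ∀ z ∈ K, ∀ i w, dist (F i z) w < ε → w ∈ K := by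
  obtain ⟨G, ⟨hG, -, hattr⟩, -⟩ := hF
  obtain ⟨K₀, hK₀, hsub⟩ := exists_compact_superset (hG.insert x)
  obtain ⟨δ, hδ, hδK⟩ := hG.exists_thickening_subset_open isOpen_interior
    ((subset_insert x G).trans hsub)
  obtain ⟨τ, hτ, hτK⟩ := hattr K₀ hK₀ δ hδ
  obtain ⟨n, rfl⟩ := Nat.exists_eq_succ_of_ne_zero hτ.ne'
  obtain ⟨K, hK, hK₀K, ε, hε, h⟩ := F.exists_isCompact_leaving_through n hK₀ isOpen_interior
    fun I hI => (hτK I hI.ge).trans hδK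
  refine ⟨K, hK, hK₀K (interior_subset (hsub (mem_insert x G))), ε, hε, fun z hz i w hw => ?_⟩
  exact (h z hz i w hw).elim id fun hw => hK₀K (interior_subset hw)

/-! ### Chains cannot cross a nonrecurrent level -/

/-- A stream with countably many weak nodes contains every pair `(x, y)` of the chain stream such that
`x` lies in a compact set trapping all `ε`-chains for some `ε`. -/
theorem IsStream.mem_of_mem_chainStream {F : IFS m X} {S : Set (X × X)} (hS : F.IsStream S)
    (hcount : (F.weakNodes S).Countable) {K : Set X} (hK : IsCompact K) {ε : ℝ} (hε : 0 < ε)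
    (htrap : ∀ z ∈ K, ∀ i w, dist (F i z) w < ε → w ∈ K) {x y : X} (hx : x ∈ K)
    (hxy : (x, y) ∈ F.chainStream) : (x, y) ∈ S := by
  by_contra hxyS
  have hy : y ∈ K := (hxy ε hε).mem_of_trapping htrap hx
  have hmaps : ∀ i, MapsTo (F i) K K := fun i z hz => htrap z hz i _ (by simpa using hε)
  have : CompactSpace K := isCompact_iff_compactSpace.1 hK
  let R : Set (K × K) := {p | (p.1.1, p.2.1) ∈ S}
  have hR : IsClosed R := hS.isClosed.preimage (by fun_prop)
  have hrefl : ∀ z, (z, z) ∈ R := fun z => hS.refl z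
  have htrans : ∀ u v w, (u, v) ∈ R → (v, w) ∈ R → (u, w) ∈ R := fun u v w => hS.trans u v w
  obtain ⟨f, hf, hf01, hfx, hfy⟩ := exists_continuous_antitone_separating hR hrefl htrans
    (a := ⟨x, hx⟩) (b := ⟨y, hy⟩) hxyS
  obtain ⟨g, hg, hg'⟩ := exists_continuous_strictly_antitone hR hrefl htrans
  -- `B` exceeds the oscillation of `g`, so `B • f + g` keeps the strictness of `g` while `f` forces
  -- L x < L y.
  obtain ⟨B, hB, hgB⟩ : ∃ B : ℝ, 0 < B ∧ ∀ z w, g z - g w < B := by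
    refine ⟨2 * ‖g‖ + 1, by positivity, fun z w => ?_⟩
    linarith [(abs_le.1 (g.norm_coe_le_norm z)).2, (abs_le.1 (g.norm_coe_le_norm w)).1]
  let L : C(K, ℝ) := B • f + g
  have hL : ∀ z w, (z, w) ∈ R → L w ≤ L z := fun z w h =>
    add_le_add (mul_le_mul_of_nonneg_left (hf z w h) hB.le) (hg z w h)
  have hL' : ∀ z w, (z, w) ∈ R → (w, z) ∉ R → L w < L z := fun z w h h' =>
    add_lt_add_of_le_of_lt (mul_le_mul_of_nonneg_left (hf z w h) hB.le) (hg' z w h h')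
  have hLxy : L ⟨x, hx⟩ < L ⟨y, hy⟩ := by
    simp only [L, ContinuousMap.add_apply, ContinuousMap.smul_apply, hfx, hfy, smul_eq_mul]
    linarith [hgB ⟨x, hx⟩ ⟨y, hy⟩]
  have hvalues : (L '' {z | F.WeaklyRecurrent S z}).Countable := by
    have hnode : ∀ N ∈ F.weakNodes S, {t | ∃ z : K, z.1 ∈ N ∧ L z = t}.Subsingleton := by
      rintro _ ⟨u, -, rfl⟩ _ ⟨z, hz, rfl⟩ _ ⟨w, hw, rfl⟩
      exact le_antisymm (hL w z (hS.trans _ _ _ hw.2 hz.1)) (hL z w (hS.trans _ _ _ hz.2 hw.1))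
    refine (hcount.biUnion fun N hN => (hnode N hN).countable).mono ?_
    rintro _ ⟨z, hz, rfl⟩
    exact mem_iUnion₂.2 ⟨_, ⟨z, hz, rfl⟩, z, ⟨hS.refl _, hS.refl _⟩, rfl⟩
  obtain ⟨c, hc, hcx, hcy⟩ := (hvalues.dense_compl ℝ).exists_between hLxy
  let φ : Fin m → K → K := fun i => (hmaps i).restrict
  have hφ : ∀ i, Continuous (φ i) := fun i =>
    (F i).continuous.continuousOn.mapsToRestrict (hmaps i)
  -- Equality would make z and its image equivalent, so z would be weakly recurrent with value c.
  have hdecr : ∀ z i, L z ≤ c → L (φ i z) < c := by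
    intro z i hz
    have hzi : (z, φ i z) ∈ R := hS.map_mem i z
    refine ((hL _ _ hzi).trans hz).lt_of_ne fun heq => hc ⟨z, ?_, le_antisymm hz ?_⟩
    · have hiz : (φ i z, z) ∈ R := by
        by_contra hiz
        exact ((hL' _ _ hzi hiz).trans_le hz).ne heq
      by_cases hfix : F i z = z
      · exact Or.inl ⟨i, hfix⟩
      · exact Or.inr ⟨F i z, hfix, hzi, hiz⟩
    · exact heq.ge.trans (hL _ _ hzi)
  have hQ : IsCompact (⋃ i, φ i '' {z | L z ≤ c}) := isCompact_iUnion fun i =>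
    (isClosed_le L.continuous continuous_const).isCompact.image (hφ i)
  obtain ⟨δ, hδ, hδc⟩ := hQ.exists_thickening_subset_open
    (isOpen_lt L.continuous (continuous_const (y := c))) (by
      refine iUnion_subset fun i => ?_
      rintro _ ⟨z, hz, rfl⟩
      exact hdecr z i hz)
  have hyQ : y ∈ Subtype.val '' {z : K | L z ≤ c} := by
    refine (hxy (min ε δ) (lt_min hε hδ)).mem_of_trapping ?_ ⟨⟨x, hx⟩, hcx.le, rfl⟩
    rintro _ ⟨z, hz, rfl⟩ i w hw
    refine ⟨⟨w, htrap z z.2 i w (hw.trans_le (min_le_left _ _))⟩, ?_, rfl⟩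
    refine le_of_lt (α := ℝ) (hδc (Metric.mem_thickening_iff.2 ⟨φ i z, ?_, ?_⟩))
    · exact mem_iUnion.2 ⟨i, mem_image_of_mem _ hz⟩
    · rw [dist_comm]
      exact hw.trans_le (min_le_right _ _)
  obtain ⟨z, hz, rfl⟩ := hyQ
  exact hcy.not_ge hz

end IFS

/-- If an iterated function system on a locally compact metric space has compact dynamics and its
smallest stream has countably many weak nodes, then its smallest stream is its chain stream. -/
theorem mainTheorem3 {X : Type*} [MetricSpace X] [LocallyCompactSpace X] {m : ℕ} (F : IFS m X)
    (hF : F.CompactDynamics) (hcount : (F.weakNodes F.smallestStream).Countable) :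
    F.smallestStream = F.chainStream := by
  refine Subset.antisymm (sInter_subset_of_mem F.isStream_chainStream) ?_
  rintro ⟨x, y⟩ hxy
  obtain ⟨K, hK, hx, ε, hε, htrap⟩ := hF.exists_isCompact_trapping x
  exact F.isStream_smallestStream.mem_of_mem_chainStream hcount hK hε htrap hx hxy
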